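/- Let $(X,\mathscr B,\nu)$ be a $\sigma$-finite measure space, $\mathscr B_{fin}=\{A\in\mathscr B:\nu(A)<\infty\}$, and write $L^2(\nu)$ for the real $L^2$-space. Let $K:\mathscr B_{fin}\times\mathscr B_{fin}\to\mathbb R$ have a factorization $K(A,B)=\langle k_A,k_B\rangle_{L^2(\nu)}$ with $k_A\in L^2(\nu)$, and let $S$ be a closed linear operator in $L^2(\nu)$ (for example a self-adjoint one) such that $\mathscr D_{fin}=\operatorname{span}\{\chi_A: A\in\mathscr B_{fin}\}$ is a core for $S$ and $S\chi_A=k_A$ for all $A\in\mathscr B_{fin}$. Let $\dot{\mathbb R}$ be the one-point compactification of $\mathbb R$, $\Omega=\dot{\mathbb R}^{\mathscr B_{fin}}$ with its cylinder $\sigma$-algebra $\mathscr C$, and let $\mathbb P$ be the Gaussian measure on $(\Omega,\mathscr C)$ for which, with $W_A(\omega)=\omega(A)$, every $(W_{A_1},\dots,W_{A_n})$ has the centred Gaussian law on $\mathbb R^n$ with covariance matrix $(K(A_i,A_j))_{i,j}$. For a countable partition $\{A_i\}\subset\mathscr B_{fin}$ of $X$ and a step function $\varphi=\sum_i\alpha_i\chi_{A_i}$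 (finitely many $\alpha_i\neq0$) put $\int\varphi\,dW=\sum_i\alpha_iW_{A_i}$. For a measurable $\varphi:X\to\mathbb R$, a random variable $F$ is called (a version of) the Itô integral $\int\varphi\,dW$ if there are step functions $\varphi_n$ of this kind (the partition may depend on $n$) with $\varphi_n\to\varphi$ in $L^2(\nu)$ and $\int\varphi_n\,dW\to F$ in $\mathbb P$-probability. Then, for measurable $\varphi,\psi:X\to\mathbb R$: 1. the Itô integral $\int\varphi\,dW$ exists and lies in $L^2(\Omega,\mathscr C,\mathbb P)$ if and only if $\varphi\in\operatorname{dom}(S)$ (that is, $\varphi\in L^2(\nu)$ and its class belongs to the domain of $S$); 2. if $\varphi\in\operatorname{dom}(S)$, then every version of $\int\varphi\,dW$ lies in $L^2(\Omega,\mathscr C,\mathbb P)$ and $\mathbb E\big(|\int\varphi\,dW|^2\big)=\|S\varphi\|_{L^2(\nu)}^2$; if also $\psi\in\operatorname{dom}(S)$, then $(\int\varphi\,dW)(\int\psi\,dW)$ is integrable and $\mathbb E\big((\int\varphi\,dW)(\int\psi\,dW)\big)=\langle S\varphi,S\psi\rangle_{L^2(\nu)}$. -/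

import Mathlib

open MeasureTheory ProbabilityTheory Filter Topology
open scoped ENNReal

namespace KernelField

/-- The Borel sigma-algebra of the one-point compactification of the real line. -/
instance instMeasurableSpaceOnePointReal : MeasurableSpace (OnePoint ℝ) := borel (OnePoint ℝ)

instance instBorelSpaceOnePointReal : BorelSpace (OnePoint ℝ) := ⟨rfl⟩

variable {X : Type*} [MeasurableSpace X]

/-- The measurable sets of finite `ν`-measure. -/
abbrev Bfin (ν : Measure X) : Type _ := {A : Set X // MeasurableSet A ∧ ν A < ∞}

/-- The indicator function of `A`, as an element of `L²(ν)`. -/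
noncomputable def chi (ν : Measure X) (A : Bfin ν) : Lp ℝ 2 ν :=
  indicatorConstLp 2 A.2.1 A.2.2.ne (1 : ℝ)

/-- The span in `L²(ν)` of the indicator functions of sets of finite measure. -/
noncomputable def Dfin (ν : Measure X) : Submodule ℝ (Lp ℝ 2 ν) :=
  Submodule.span ℝ (Set.range (chi ν))

/-- The path space; it carries the product (cylinder) sigma-algebra. -/
abbrev PathSpace (ν : Measure X) : Type _ := Bfin ν → OnePoint ℝ

/-- The coordinate `ω ↦ ω A` as a real random variable. The point at infinity, which the
coordinates hit with probability zero, is sent to `0`. -/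
def W (ν : Measure X) (A : Bfin ν) (ω : PathSpace ν) : ℝ := (ω A).elim 0 id

/-- `P` is the Gaussian measure on path space indexed by `K`: for every finite family
`A₁, …, Aₙ`, the law of `(ω A₁, …, ω Aₙ)` is the centred Gaussian on `ℝⁿ` with covariance
matrix `(K Aᵢ Aⱼ)`, transported to the product of the compactifications. -/
def IsGaussianPathMeasure (ν : Measure X) (K : Bfin ν → Bfin ν → ℝ)
    (P : Measure (PathSpace ν)) : Prop :=
  ∀ (n : ℕ) (A : Fin n → Bfin ν),
    P.map (fun ω i => ω (A i)) =
      (multivariateGaussian 0 (Matrix.of fun i j => K (A i) (A j))).map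
        (fun (x : EuclideanSpace ℝ (Fin n)) i => ((x i : ℝ) : OnePoint ℝ))

/-- A countable partition of `X` into sets of finite measure; cells may be empty, so finite
partitions are included. -/
structure Partition (ν : Measure X) where
  cell : ℕ → Bfin ν
  disjoint : Pairwise fun i j => Disjoint (cell i : Set X) (cell j : Set X)
  cover : ⋃ i, (cell i : Set X) = Set.univ

/-- The step function `∑ αᵢ χ_{Aᵢ}` on the cells of a partition (finitely many `αᵢ ≠ 0`). -/
noncomputable def Partition.step {ν : Measure X} (𝒜 : Partition ν) (α : ℕ →₀ ℝ) (x : X) : ℝ :=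
  ∑ i ∈ α.support, α i * (𝒜.cell i : Set X).indicator (fun _ => (1 : ℝ)) x

/-- The Itô integral `∑ αᵢ W_{Aᵢ}` of the step function `∑ αᵢ χ_{Aᵢ}`. -/
noncomputable def Partition.stepIto {ν : Measure X} (𝒜 : Partition ν) (α : ℕ →₀ ℝ)
    (ω : PathSpace ν) : ℝ :=
  ∑ i ∈ α.support, α i * W ν (𝒜.cell i) ω

/-- The random variable `F` is (a version of) the Itô integral `∫ φ dW`: there are step functions
over partitions which converge to `φ` in `L²(ν)` and whose Itô integrals converge to `F` in
probability. Square integrability of `F` is not part of the definition. -/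
def IsItoIntegral (ν : Measure X) (P : Measure (PathSpace ν)) (φ : X → ℝ)
    (F : PathSpace ν → ℝ) : Prop :=
  ∃ (𝒜 : ℕ → Partition ν) (α : ℕ → ℕ →₀ ℝ),
    Tendsto (fun n => eLpNorm (fun x => (𝒜 n).step (α n) x - φ x) 2 ν) atTop (𝓝 0) ∧
    TendstoInMeasure P (fun n => (𝒜 n).stepIto (α n)) atTop F

end KernelField

namespace KernelField

variable {X : Type*} [MeasurableSpace X]

/-! The same finitely supported coefficients `c` define a function `∑ c_A χ_A`, its image `∑ c_A
k_A` under `S`, and a random variable `∑ c_A W_A`. Since `K` is the covariance, the last two have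
the same inner products (`inner_integralLp`). Working with coefficients also avoids asking whether
the integral depends on how a step function is written.

If step integrals converge in probability, their differences are centred Gaussians tending to zero
in probability, so their variances tend to zero (`cauchySeq_of_tendstoInMeasure`). By the isometry
the images under `S` are then Cauchy, and closedness of `S` puts the limit `φ` in its domain, with
`S φ` the limit of the images. Conversely, the core property approximates `(φ, S φ)` in the graph by
step functions (`exists_partition_tendsto`), and the isometry makes their integrals converge in
`L²`. The formulas for second moments pass to the limit. -/

lemma measurable_onePoint_elim_zero : Measurable fun y : OnePoint ℝ => (y.elim 0 id : ℝ) := by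
  intro s hs
  have hs' : MeasurableSet (((↑) : ℝ → OnePoint ℝ) '' s) :=
    OnePoint.isOpenEmbedding_coe.measurableEmbedding.measurableSet_image.2 hs
  by_cases h0 : (0 : ℝ) ∈ s
  · convert hs'.union (measurableSet_singleton (OnePoint.infty : OnePoint ℝ)) using 1
    ext y
    induction y using OnePoint.rec <;> simp [h0]
  · convert hs' using 1
    ext y
    induction y using OnePoint.rec <;> simp [h0]

lemma measurable_W (ν : Measure X) (A : Bfin ν) : Measurable (W ν A) :=
  measurable_onePoint_elim_zero.comp (measurable_pi_apply A)

/-! ### Joint laws and moments of the coordinates. -/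

variable {ν : Measure X} {K : Bfin ν → Bfin ν → ℝ} {P : Measure (PathSpace ν)}

/-- The real coordinates of a Gaussian path measure are jointly Gaussian. -/
lemma IsGaussianPathMeasure.hasLaw (hP : IsGaussianPathMeasure ν K P) {n : ℕ}
    (A : Fin n → Bfin ν) :
    HasLaw (fun ω => WithLp.toLp 2 fun i => W ν (A i) ω)
      (multivariateGaussian 0 (Matrix.of fun i j => K (A i) (A j))) P where
  aemeasurable := by
    refine Measurable.aemeasurable ?_
    exact (WithLp.measurable_toLp 2 _).comp (measurable_pi_lambda _ fun i => measurable_W ν (A i))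
  map_eq := by
    have hr : Measurable fun (y : Fin n → OnePoint ℝ) =>
        WithLp.toLp 2 fun i => ((y i).elim 0 id : ℝ) :=
      (WithLp.measurable_toLp 2 _).comp (measurable_pi_lambda _ fun i =>
        measurable_onePoint_elim_zero.comp (measurable_pi_apply i))
    have hc : Measurable fun (x : EuclideanSpace ℝ (Fin n)) i => ((x i : ℝ) : OnePoint ℝ) :=
      measurable_pi_lambda _ fun i =>
        OnePoint.continuous_coe.measurable.comp (by fun_prop)
    -- Push both laws forward along the retraction to `ℝⁿ`. It is a left inverse of the coercion, so
    -- the right-hand side becomes the Gaussian itself.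
    have h := congrArg (Measure.map fun (y : Fin n → OnePoint ℝ) =>
        WithLp.toLp 2 fun i => ((y i).elim 0 id : ℝ)) (hP n A)
    rw [Measure.map_map hr (measurable_pi_lambda _ fun i => measurable_pi_apply (A i)),
      Measure.map_map hr hc] at h
    refine h.trans ?_
    exact Measure.map_id

/-- The empty family already fixes the total mass. -/
lemma IsGaussianPathMeasure.isProbabilityMeasure (hP : IsGaussianPathMeasure ν K P) :
    IsProbabilityMeasure P :=
  (hP.hasLaw (n := 0) Fin.elim0).hasGaussianLaw.isProbabilityMeasure

lemma IsGaussianPathMeasure.hasGaussianLaw_sum (hP : IsGaussianPathMeasure ν K P) {n : ℕ}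
    (A : Fin n → Bfin ν) (a : Fin n → ℝ) :
    HasGaussianLaw (fun ω => ∑ i, a i * W ν (A i) ω) P := by
  have h := (hP.hasLaw A).hasGaussianLaw.map_fun (innerSL ℝ (WithLp.toLp 2 a))
  simpa [PiLp.inner_apply, mul_comm] using h

lemma IsGaussianPathMeasure.hasGaussianLaw_W (hP : IsGaussianPathMeasure ν K P) (A : Bfin ν) :
    HasGaussianLaw (W ν A) P := by
  simpa using hP.hasGaussianLaw_sum (n := 1) (fun _ => A) (fun _ => 1)

lemma IsGaussianPathMeasure.memLp_W (hP : IsGaussianPathMeasure ν K P) (A : Bfin ν) :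
    MemLp (W ν A) 2 P :=
  (hP.hasGaussianLaw_W A).memLp_two

lemma IsGaussianPathMeasure.integral_W (hP : IsGaussianPathMeasure ν K P) (A : Bfin ν) :
    ∫ ω, W ν A ω ∂P = 0 := by
  have h := (hP.hasLaw (n := 1) fun _ => A).integral_comp
    (f := fun x : EuclideanSpace ℝ (Fin 1) => x 0) (by fun_prop)
  have h' := ContinuousLinearMap.integral_comp_comm (EuclideanSpace.proj (𝕜 := ℝ) (0 : Fin 1))
    (IsGaussian.integrable_fun_id (μ := multivariateGaussian (0 : EuclideanSpace ℝ (Fin 1))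
      (Matrix.of fun _ _ => K A A)))
  rw [integral_id_multivariateGaussian] at h'
  exact h.trans h'

lemma IsGaussianPathMeasure.integral_W_mul_W (hP : IsGaussianPathMeasure ν K P)
    {H : Type*} [NormedAddCommGroup H] [InnerProductSpace ℝ H] {k : Bfin ν → H}
    (hK : ∀ A B, K A B = inner ℝ (k A) (k B)) (A B : Bfin ν) :
    ∫ ω, W ν A ω * W ν B ω ∂P = K A B := by
  have := hP.isProbabilityMeasure
  -- The covariance formula for `multivariateGaussian` needs a positive semidefinite matrix; the
  -- factorization of `K` makes this one a Gram matrix.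
  have hS : (Matrix.of fun i j : Fin 2 => K (![A, B] i) (![A, B] j)).PosSemidef := by
    have h := Matrix.posSemidef_gram ℝ fun i : Fin 2 => k (![A, B] i)
    have he : Matrix.gram ℝ (fun i : Fin 2 => k (![A, B] i)) =
        Matrix.of fun i j : Fin 2 => K (![A, B] i) (![A, B] j) := by
      ext i j
      simp [Matrix.gram_apply, hK]
    rwa [he] at h
  have h := (hP.hasLaw ![A, B]).covariance_comp
    (f := fun x : EuclideanSpace ℝ (Fin 2) => x 0) (g := fun x => x 1) (by fun_prop) (by fun_prop)
  rw [covariance_eval_multivariateGaussian hS] at h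
  have h' : cov[W ν A, W ν B; P] = K A B := by simpa [Function.comp_def] using h
  rw [covariance_eq_sub (hP.memLp_W A) (hP.memLp_W B), hP.integral_W] at h'
  simpa using h'

/-- A centred real Gaussian is bounded away from zero, at the scale of its standard deviation,
with a probability that does not depend on the scale. -/
lemma gaussianReal_one_le_of_le {σ ε : ℝ} (h : ε ≤ σ) :
    gaussianReal 0 1 {x | 1 ≤ |x|} ≤ gaussianReal 0 (σ ^ 2).toNNReal {x | ε ≤ |x|} := by
  have hσ := gaussianReal_map_const_mul (μ := 0) (v := 1) σ
  have : (NNReal.mk (σ ^ 2) (sq_nonneg σ) * 1) = (σ ^ 2).toNNReal := by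
    ext; simp [sq_nonneg]
  rw [mul_zero, this] at hσ
  rw [← hσ, Measure.map_apply (by fun_prop)
    (measurableSet_le measurable_const (by fun_prop))]
  refine measure_mono fun x hx => ?_
  simp only [Set.mem_ofPred_eq, Set.mem_preimage, abs_mul] at hx ⊢
  calc ε ≤ |σ| * 1 := by rw [mul_one]; exact h.trans (le_abs_self σ)
    _ ≤ |σ| * |x| := by gcongr

lemma gaussianReal_one_le_abs_pos : 0 < gaussianReal 0 1 {x | 1 ≤ |x|} := by
  refine pos_iff_ne_zero.2 fun h0 => ?_
  -- A null set of the standard Gaussian is Lebesgue null, but this set contains `[1, 2]`.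
  have h := gaussianReal_absolutelyContinuous' 0 one_ne_zero h0
  have h1 : volume (Set.Icc (1 : ℝ) 2) = 0 :=
    measure_mono_null (fun x hx => hx.1.trans (le_abs_self x)) h
  norm_num at h1

/-! ### Step functions and their integrals as formal combinations. -/

lemma coeFn_linearCombination_toLp {Ω ι : Type*} [MeasurableSpace Ω] {μ : Measure Ω} {p : ℝ≥0∞}
    {f : ι → Ω → ℝ} (hf : ∀ i, MemLp (f i) p μ) (c : ι →₀ ℝ) :
    Finsupp.linearCombination ℝ (fun i => (hf i).toLp (f i)) c
      =ᵐ[μ] fun ω => ∑ i ∈ c.support, c i * f i ω := by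
  rw [Finsupp.linearCombination_apply, Finsupp.sum]
  refine (Lp.coeFn_fun_finsetSum _ _).trans ?_
  have h : ∀ᵐ ω ∂μ, ∀ i ∈ c.support, (c i • (hf i).toLp (f i)) ω = c i * f i ω := by
    refine (Finset.eventually_all _).2 fun i _ => ?_
    filter_upwards [Lp.coeFn_smul (c i) ((hf i).toLp (f i)), (hf i).coeFn_toLp] with ω h₁ h₂
    rw [h₁, Pi.smul_apply, h₂, smul_eq_mul]
  filter_upwards [h] with ω hω using Finset.sum_congr rfl hω

/-- The random variable `∑ c_A W_A` as an element of `L²(P)`. -/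
noncomputable def IsGaussianPathMeasure.integralLp (hP : IsGaussianPathMeasure ν K P) :
    (Bfin ν →₀ ℝ) →ₗ[ℝ] Lp ℝ 2 P :=
  Finsupp.linearCombination ℝ fun A => (hP.memLp_W A).toLp (W ν A)

lemma IsGaussianPathMeasure.coeFn_integralLp (hP : IsGaussianPathMeasure ν K P)
    (c : Bfin ν →₀ ℝ) :
    hP.integralLp c =ᵐ[P] fun ω => ∑ A ∈ c.support, c A * W ν A ω :=
  coeFn_linearCombination_toLp hP.memLp_W c

/-- Different indices may carry the same cell, necessarily empty; `mapDomain` adds their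
coefficients, which leaves the sum unchanged. -/
lemma IsGaussianPathMeasure.stepIto_ae_eq (hP : IsGaussianPathMeasure ν K P) (𝒜 : Partition ν)
    (α : ℕ →₀ ℝ) : 𝒜.stepIto α =ᵐ[P] hP.integralLp (α.mapDomain 𝒜.cell) := by
  rw [IsGaussianPathMeasure.integralLp, Finsupp.linearCombination_mapDomain]
  exact (coeFn_linearCombination_toLp (fun i => hP.memLp_W (𝒜.cell i)) α).symm

lemma Partition.step_ae_eq (𝒜 : Partition ν) (α : ℕ →₀ ℝ) :
    𝒜.step α =ᵐ[ν] Finsupp.linearCombination ℝ (chi ν) (α.mapDomain 𝒜.cell) := by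
  rw [Finsupp.linearCombination_mapDomain]
  exact (coeFn_linearCombination_toLp
    (fun i => memLp_indicator_const 2 (𝒜.cell i).2.1 (1 : ℝ) (.inr (𝒜.cell i).2.2.ne)) α).symm

/-! ### The isometry and convergence in probability. -/

section Isometry

variable {H : Type*} [NormedAddCommGroup H] [InnerProductSpace ℝ H] {k : Bfin ν → H}

/-- Both sides are bilinear in the coefficients, so the covariance of two coordinates suffices. -/
lemma IsGaussianPathMeasure.inner_integralLp (hP : IsGaussianPathMeasure ν K P)
    (hK : ∀ A B, K A B = inner ℝ (k A) (k B)) (c d : Bfin ν →₀ ℝ) :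
    inner ℝ (hP.integralLp c) (hP.integralLp d) =
      inner ℝ (Finsupp.linearCombination ℝ k c) (Finsupp.linearCombination ℝ k d) := by
  have h (A B : Bfin ν) : inner ℝ ((hP.memLp_W A).toLp (W ν A)) ((hP.memLp_W B).toLp (W ν B)) =
      inner ℝ (k A) (k B) := by
    rw [← hK, ← hP.integral_W_mul_W hK, L2.inner_def]
    refine integral_congr_ae ?_
    filter_upwards [(hP.memLp_W A).coeFn_toLp, (hP.memLp_W B).coeFn_toLp] with ω h₁ h₂
    rw [h₁, h₂]
    simp [mul_comm]
  simp only [IsGaussianPathMeasure.integralLp, Finsupp.linearCombination_apply, Finsupp.sum,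
    sum_inner, inner_sum, real_inner_smul_left, real_inner_smul_right, h]

lemma IsGaussianPathMeasure.norm_integralLp (hP : IsGaussianPathMeasure ν K P)
    (hK : ∀ A B, K A B = inner ℝ (k A) (k B)) (c : Bfin ν →₀ ℝ) :
    ‖hP.integralLp c‖ = ‖Finsupp.linearCombination ℝ k c‖ := by
  rw [norm_eq_sqrt_real_inner, hP.inner_integralLp hK, ← norm_eq_sqrt_real_inner]

lemma IsGaussianPathMeasure.map_integralLp (hP : IsGaussianPathMeasure ν K P)
    (hK : ∀ A B, K A B = inner ℝ (k A) (k B)) (c : Bfin ν →₀ ℝ) :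
    P.map (hP.integralLp c) =
      gaussianReal 0 (‖Finsupp.linearCombination ℝ k c‖ ^ 2).toNNReal := by
  have := hP.isProbabilityMeasure
  have hG : HasGaussianLaw (hP.integralLp c) P := by
    let e := c.support.equivFin
    refine (hP.hasGaussianLaw_sum (fun i => (e.symm i : Bfin ν))
      (fun i => c (e.symm i))).congr ?_
    filter_upwards [hP.coeFn_integralLp c] with ω hω
    rw [hω, ← Finset.sum_coe_sort c.support fun A => c A * W ν A ω]
    exact Equiv.sum_comp e.symm fun A : c.support => c A * W ν A ω
  have hm : ∫ ω, hP.integralLp c ω ∂P = 0 := by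
    rw [integral_congr_ae (hP.coeFn_integralLp c), integral_finsetSum]
    · simp [integral_const_mul, hP.integral_W]
    · exact fun A _ => ((hP.memLp_W A).integrable one_le_two).const_mul _
  rw [hG.map_eq_gaussianReal, hm, variance_of_integral_eq_zero hG.aemeasurable hm,
    ← hP.norm_integralLp hK, ← real_inner_self_eq_norm_sq, L2.inner_def]
  simp [sq]

/-- Wiener integrals that converge in probability have Cauchy integrands for the covariance
seminorm: this is where Gaussianity enters. -/
lemma IsGaussianPathMeasure.cauchySeq_of_tendstoInMeasure (hP : IsGaussianPathMeasure ν K P)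
    (hK : ∀ A B, K A B = inner ℝ (k A) (k B)) {c : ℕ → Bfin ν →₀ ℝ} {F : PathSpace ν → ℝ}
    (hF : TendstoInMeasure P (fun n => hP.integralLp (c n)) atTop F) :
    CauchySeq fun n => Finsupp.linearCombination ℝ k (c n) := by
  have := hP.isProbabilityMeasure
  set δ := gaussianReal 0 1 {x : ℝ | 1 ≤ |x|} with hδ
  have hδ0 : 0 < δ := gaussianReal_one_le_abs_pos
  refine Metric.cauchySeq_iff'.2 fun ε hε => ?_
  rw [tendstoInMeasure_iff_norm] at hF
  -- From `N` on, the deviation from `F` reaches `ε / 2` with probability below `δ / 2`. If two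
  -- integrands were at distance at least `ε`, the difference of their integrals would reach `ε`
  -- with probability at least `δ`; by the triangle inequality one of the two deviations would then
  -- reach `ε / 2`, an event of probability below `δ`.
  obtain ⟨N, hN⟩ := eventually_atTop.1
    ((hF (ε / 2) (half_pos hε)).eventually (gt_mem_nhds (ENNReal.half_pos hδ0.ne')))
  refine ⟨N, fun n hn => ?_⟩
  by_contra! hge
  rw [dist_eq_norm, ← map_sub] at hge
  have h₁ := gaussianReal_one_le_of_le hge
  rw [← hP.map_integralLp hK, Measure.map_apply_of_aemeasurable
    (Lp.aestronglyMeasurable _).aemeasurable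
    (measurableSet_le measurable_const (by fun_prop))] at h₁
  refine (h₁.trans ?_).not_gt (((ENNReal.add_lt_add (hN n hn) (hN N le_rfl))).trans_eq
    (ENNReal.add_halves _))
  refine le_trans (measure_mono_ae ?_) (measure_union_le _ _)
  rw [map_sub]
  filter_upwards [Lp.coeFn_sub (hP.integralLp (c n)) (hP.integralLp (c N))] with ω hω h
  have h' : ε ≤ |hP.integralLp (c n) ω - hP.integralLp (c N) ω| := by
    have : ε ≤ |(hP.integralLp (c n) - hP.integralLp (c N)) ω| := h
    rwa [hω] at this
  by_contra hcon
  have hcon' : ¬(ε / 2 ≤ ‖hP.integralLp (c n) ω - F ω‖ ∨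
      ε / 2 ≤ ‖hP.integralLp (c N) ω - F ω‖) := hcon
  simp only [not_or, not_le, Real.norm_eq_abs] at hcon'
  have := abs_sub_le (hP.integralLp (c n) ω) (F ω) (hP.integralLp (c N) ω)
  rw [abs_sub_comm (F ω)] at this
  linarith [hcon'.1, hcon'.2]

lemma IsGaussianPathMeasure.cauchySeq_integralLp (hP : IsGaussianPathMeasure ν K P)
    (hK : ∀ A B, K A B = inner ℝ (k A) (k B)) {c : ℕ → Bfin ν →₀ ℝ}
    (hc : CauchySeq fun n => Finsupp.linearCombination ℝ k (c n)) :
    CauchySeq fun n => hP.integralLp (c n) := by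
  refine Metric.cauchySeq_iff'.2 fun ε hε => ?_
  obtain ⟨N, hN⟩ := Metric.cauchySeq_iff'.1 hc ε hε
  refine ⟨N, fun n hn => ?_⟩
  have := hN n hn
  rwa [dist_eq_norm, ← map_sub, ← hP.norm_integralLp hK, map_sub, ← dist_eq_norm] at this

/-- For Wiener integrals, convergence in probability implies convergence in `L²`. -/
lemma IsGaussianPathMeasure.exists_tendsto_integralLp (hP : IsGaussianPathMeasure ν K P)
    (hK : ∀ A B, K A B = inner ℝ (k A) (k B)) {c : ℕ → Bfin ν →₀ ℝ} {F : PathSpace ν → ℝ}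
    (hF : TendstoInMeasure P (fun n => hP.integralLp (c n)) atTop F) :
    ∃ h : MemLp F 2 P, Tendsto (fun n => hP.integralLp (c n)) atTop (𝓝 (h.toLp F)) := by
  obtain ⟨G, hG⟩ := cauchySeq_tendsto_of_complete
    (hP.cauchySeq_integralLp hK (hP.cauchySeq_of_tendstoInMeasure hK hF))
  have hFG : G =ᵐ[P] F := tendstoInMeasure_ae_unique (tendstoInMeasure_of_tendsto_Lp hG) hF
  have h : MemLp F 2 P := (memLp_congr_ae hFG).1 (Lp.memLp G)
  refine ⟨h, ?_⟩
  convert hG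
  exact Lp.ext (h.coeFn_toLp.trans hFG.symm)

end Isometry

/-! ### Realizing the span of indicators by partitions. -/

lemma Partition.step_apply (𝒜 : Partition ν) (α : ℕ →₀ ℝ) {x : X} {i : ℕ}
    (hx : x ∈ (𝒜.cell i : Set X)) : 𝒜.step α x = α i := by
  rw [Partition.step, Finset.sum_eq_single i]
  · simp [hx]
  · intro j _ hji
    have : x ∉ (𝒜.cell j : Set X) := fun hj => Set.disjoint_left.1 (𝒜.disjoint hji) hj hx
    simp [this]
  · intro hi
    simp [Finsupp.notMem_support_iff.1 hi]

/-- A simple function of finite-measure support is a step function over a partition: the cells are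
its nonzero level sets, and a decomposition of its zero set into sets of finite measure. -/
lemma exists_partition_step_eq [SigmaFinite ν] (f : SimpleFunc X ℝ) (hf : f.FinMeasSupp ν) :
    ∃ (𝒜 : Partition ν) (α : ℕ →₀ ℝ), 𝒜.step α = f := by
  classical
  let s : Finset ℝ := f.range.erase 0
  let D : ℕ → Set X := disjointed (spanningSets ν)
  have hDm (n : ℕ) : MeasurableSet (D n) :=
    MeasurableSet.disjointed (measurableSet_spanningSets ν) n
  have hDf (n : ℕ) : ν (D n) < ∞ :=
    (measure_mono (disjointed_subset _ n)).trans_lt (measure_spanningSets_lt_top ν n)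
  -- Finitely many nonzero levels, together with the pieces of the zero set, are reindexed by `ℕ`.
  obtain ⟨e⟩ : Nonempty (↥s ⊕ ℕ ≃ ℕ) := by
    obtain ⟨_⟩ := nonempty_denumerable (↥s ⊕ ℕ)
    exact ⟨Denumerable.eqv _⟩
  let C : ↥s ⊕ ℕ → Bfin ν := Sum.elim
    (fun y => ⟨f ⁻¹' {y.1}, f.measurableSet_fiber y.1,
      SimpleFunc.finMeasSupp_iff.1 hf y.1 (Finset.ne_of_mem_erase y.2)⟩)
    (fun n => ⟨f ⁻¹' {0} ∩ D n, (f.measurableSet_fiber 0).inter (hDm n),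
      (measure_mono Set.inter_subset_right).trans_lt (hDf n)⟩)
  let val : ↥s ⊕ ℕ → ℝ := Sum.elim (fun y => y.1) fun _ => 0
  have hval (i : ↥s ⊕ ℕ) {x : X} (hx : x ∈ (C i : Set X)) : f x = val i := by
    rcases i with y | n
    · exact hx
    · exact hx.1
  have hdisj : Pairwise fun i j => Disjoint (C i : Set X) (C j : Set X) := by
    intro i j hij
    refine Set.disjoint_left.2 fun x hi hj => ?_
    have h := (hval i hi).symm.trans (hval j hj)
    rcases i with y | n <;> rcases j with z | m
    · exact hij (congrArg Sum.inl (Subtype.ext h))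
    · exact Finset.ne_of_mem_erase y.2 h
    · exact Finset.ne_of_mem_erase z.2 h.symm
    · exact Set.disjoint_left.1 (disjoint_disjointed _ fun hnm => hij (congrArg Sum.inr hnm))
        hi.2 hj.2
  have hcov (x : X) : ∃ i, x ∈ (C i : Set X) := by
    by_cases hx : f x = 0
    · have : x ∈ ⋃ n, D n := by
        rw [iUnion_disjointed, iUnion_spanningSets]
        trivial
      obtain ⟨n, hn⟩ := Set.mem_iUnion.1 this
      exact ⟨Sum.inr n, hx, hn⟩
    · exact ⟨Sum.inl ⟨f x, Finset.mem_erase.2 ⟨hx, f.mem_range_self x⟩⟩, rfl⟩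
  let 𝒜 : Partition ν :=
    { cell := fun i => C (e.symm i)
      disjoint := fun i j hij => hdisj (e.symm.injective.ne hij)
      cover := Set.eq_univ_of_forall fun x => by
        obtain ⟨i, hi⟩ := hcov x
        exact Set.mem_iUnion.2 ⟨e i, by simpa using hi⟩ }
  have hfin : (Function.support fun i => val (e.symm i)).Finite := by
    refine (Set.finite_range fun y : ↥s => e (Sum.inl y)).subset fun i hi => ?_
    rcases h : e.symm i with y | n
    · exact ⟨y, by simp [← h]⟩
    · simp [h, val] at hi
  refine ⟨𝒜, Finsupp.ofSupportFinite _ hfin, funext fun x => ?_⟩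
  obtain ⟨i, hi⟩ := hcov x
  rw [𝒜.step_apply _ (i := e i) (by simpa [𝒜] using hi), hval i hi]
  simp [Finsupp.ofSupportFinite_coe]

/-- The sets in a combination of indicators may overlap; the level sets of a simple function do not.
-/
lemma exists_simpleFunc_of_mem_Dfin {u : Lp ℝ 2 ν} (hu : u ∈ Dfin ν) :
    ∃ f : SimpleFunc X ℝ, f.FinMeasSupp ν ∧ u =ᵐ[ν] f := by
  induction hu using Submodule.span_induction with
  | mem u hu =>
    obtain ⟨A, rfl⟩ := hu
    refine ⟨SimpleFunc.piecewise A.1 A.2.1 (SimpleFunc.const X 1) (SimpleFunc.const X 0), ?_, ?_⟩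
    · rw [SimpleFunc.finMeasSupp_iff_support]
      refine (measure_mono fun x hx => ?_).trans_lt A.2.2
      by_contra hxA
      simp [hxA] at hx
    · refine (indicatorConstLp_coeFn (hs := A.2.1) (hμs := A.2.2.ne)).trans (.of_eq ?_)
      ext x
      by_cases hx : x ∈ A.1 <;> simp [hx]
  | zero =>
    exact ⟨0, by simp [SimpleFunc.finMeasSupp_iff_support], Lp.coeFn_zero _ _ _⟩
  | add u v _ _ hu hv =>
    obtain ⟨f, hf, huf⟩ := hu
    obtain ⟨g, hg, hvg⟩ := hv
    exact ⟨f + g, hf.add hg, (Lp.coeFn_add u v).trans (by simpa using huf.add hvg)⟩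
  | smul a u _ hu =>
    obtain ⟨f, hf, huf⟩ := hu
    exact ⟨f.map fun y => a * y, hf.map (mul_zero a), (Lp.coeFn_smul a u).trans <| by
      filter_upwards [huf] with x hx
      simp [hx]⟩

lemma exists_partition_of_mem_Dfin [SigmaFinite ν] {u : Lp ℝ 2 ν} (hu : u ∈ Dfin ν) :
    ∃ (𝒜 : Partition ν) (α : ℕ →₀ ℝ),
      Finsupp.linearCombination ℝ (chi ν) (α.mapDomain 𝒜.cell) = u := by
  obtain ⟨f, hf, huf⟩ := exists_simpleFunc_of_mem_Dfin hu
  obtain ⟨𝒜, α, h⟩ := exists_partition_step_eq f hf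
  refine ⟨𝒜, α, Lp.ext ((𝒜.step_ae_eq α).symm.trans ?_)⟩
  rw [h]
  exact huf.symm

/-! ### Graph approximation from the core. -/

variable {S : Lp ℝ 2 ν →ₗ.[ℝ] Lp ℝ 2 ν} {k : Bfin ν → Lp ℝ 2 ν}

lemma linearCombination_mem_graph (hSk : ∀ A, (chi ν A, k A) ∈ S.graph) (c : Bfin ν →₀ ℝ) :
    (Finsupp.linearCombination ℝ (chi ν) c, Finsupp.linearCombination ℝ k c) ∈ S.graph := by
  have h : (Finsupp.linearCombination ℝ (chi ν) c, Finsupp.linearCombination ℝ k c) =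
      ∑ A ∈ c.support, c A • (chi ν A, k A) := by
    simp [Finsupp.linearCombination_apply, Finsupp.sum, Prod.ext_iff, Prod.fst_sum, Prod.snd_sum]
  rw [h]
  exact Submodule.sum_mem _ fun A _ => Submodule.smul_mem _ _ (hSk A)

/-- A point of the graph of `S` is a limit of points over step functions. -/
lemma exists_partition_tendsto [SigmaFinite ν] (hS : S.IsClosed) (hcore : S.HasCore (Dfin ν))
    (hSk : ∀ A, (chi ν A, k A) ∈ S.graph) {u v : Lp ℝ 2 ν} (huv : (u, v) ∈ S.graph) :
    ∃ (𝒜 : ℕ → Partition ν) (α : ℕ → ℕ →₀ ℝ),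
      Tendsto (fun n => Finsupp.linearCombination ℝ (chi ν) ((α n).mapDomain (𝒜 n).cell))
        atTop (𝓝 u) ∧
      Tendsto (fun n => Finsupp.linearCombination ℝ k ((α n).mapDomain (𝒜 n).cell))
        atTop (𝓝 v) := by
  have hcl : (S.domRestrict (Dfin ν)).IsClosable :=
    hS.isClosable.leIsClosable S.domRestrict_le
  -- By the core property the graph of `S` is the closure of the graph of its restriction to `Dfin
  -- ν`.
  rw [← hcore.closure_eq, ← hcl.graph_closure_eq_closure_graph, ← SetLike.mem_coe,
    Submodule.topologicalClosure_coe, mem_closure_iff_seq_limit] at huv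
  obtain ⟨w, hw, hlim⟩ := huv
  have hw' (n : ℕ) : ∃ (𝒜 : Partition ν) (α : ℕ →₀ ℝ),
      (Finsupp.linearCombination ℝ (chi ν) (α.mapDomain 𝒜.cell),
        Finsupp.linearCombination ℝ k (α.mapDomain 𝒜.cell)) = w n := by
    have hdom : (w n).1 ∈ Dfin ν := by
      have := LinearPMap.mem_domain_of_mem_graph (hw n)
      rw [LinearPMap.domRestrict_domain] at this
      exact this.1
    obtain ⟨𝒜, α, h⟩ := exists_partition_of_mem_Dfin hdom
    refine ⟨𝒜, α, Prod.ext h ?_⟩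
    -- Second components agree because a graph is single-valued.
    exact S.mem_graph_snd_inj (linearCombination_mem_graph hSk _)
      (LinearPMap.le_graph_of_le S.domRestrict_le (hw n)) h
  choose 𝒜 α h using hw'
  rw [← funext h] at hlim
  exact ⟨𝒜, α, (continuous_fst.tendsto _).comp hlim, (continuous_snd.tendsto _).comp hlim⟩

/-! ### Itô integrals and the domain of `S`. -/

lemma IsGaussianPathMeasure.isItoIntegral_iff (hP : IsGaussianPathMeasure ν K P) {φ : X → ℝ}
    (hφ : MemLp φ 2 ν) {F : PathSpace ν → ℝ} :
    IsItoIntegral ν P φ F ↔ ∃ (𝒜 : ℕ → Partition ν) (α : ℕ → ℕ →₀ ℝ),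
      Tendsto (fun n => Finsupp.linearCombination ℝ (chi ν) ((α n).mapDomain (𝒜 n).cell))
        atTop (𝓝 (hφ.toLp φ)) ∧
      TendstoInMeasure P (fun n => hP.integralLp ((α n).mapDomain (𝒜 n).cell)) atTop F := by
  refine exists_congr fun 𝒜 => exists_congr fun α => and_congr ?_ ?_
  · rw [Lp.tendsto_Lp_iff_tendsto_eLpNorm']
    refine tendsto_congr fun n => eLpNorm_congr_ae ?_
    exact ((𝒜 n).step_ae_eq (α n)).sub hφ.coeFn_toLp.symm
  · exact ⟨fun h => h.congr_left fun n => hP.stepIto_ae_eq (𝒜 n) (α n),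
      fun h => h.congr_left fun n => (hP.stepIto_ae_eq (𝒜 n) (α n)).symm⟩

lemma IsItoIntegral.memLp {φ : X → ℝ} {F : PathSpace ν → ℝ} (hF : IsItoIntegral ν P φ F)
    (hφ : AEMeasurable φ ν) : MemLp φ 2 ν := by
  obtain ⟨𝒜, α, h, -⟩ := hF
  -- One step function at finite distance from `φ` is enough.
  obtain ⟨n, hn⟩ := (h.eventually (gt_mem_nhds ENNReal.zero_lt_top)).exists
  have hstep : MemLp ((𝒜 n).step (α n)) 2 ν :=
    (memLp_congr_ae ((𝒜 n).step_ae_eq (α n))).2 (Lp.memLp _)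
  have hsub : MemLp (fun x => (𝒜 n).step (α n) x - φ x) 2 ν :=
    ⟨hstep.1.sub hφ.aestronglyMeasurable, hn⟩
  convert hstep.sub hsub using 1
  ext x
  simp

/-- Gaussianity upgrades convergence in probability to convergence of the images under `S`, and
closedness identifies their limit as the image of `φ`. The common coefficients `c` are kept so that
the isometry can be taken to the limit. -/
lemma IsGaussianPathMeasure.exists_tendsto_of_isItoIntegral (hP : IsGaussianPathMeasure ν K P)
    (hK : ∀ A B, K A B = inner ℝ (k A) (k B)) (hS : S.IsClosed)
    (hSk : ∀ A, (chi ν A, k A) ∈ S.graph) {φ : X → ℝ} (hφ : MemLp φ 2 ν)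
    {F : PathSpace ν → ℝ} (hF : IsItoIntegral ν P φ F) :
    ∃ (g : Lp ℝ 2 ν) (hF2 : MemLp F 2 P) (c : ℕ → Bfin ν →₀ ℝ), (hφ.toLp φ, g) ∈ S.graph ∧
      Tendsto (fun n => Finsupp.linearCombination ℝ k (c n)) atTop (𝓝 g) ∧
      Tendsto (fun n => hP.integralLp (c n)) atTop (𝓝 (hF2.toLp F)) := by
  obtain ⟨𝒜, α, hlim, hF⟩ := (hP.isItoIntegral_iff hφ).1 hF
  obtain ⟨g, hg⟩ := cauchySeq_tendsto_of_complete (hP.cauchySeq_of_tendstoInMeasure hK hF)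
  obtain ⟨hF2, hF⟩ := hP.exists_tendsto_integralLp hK hF
  exact ⟨g, hF2, _, hS.mem_of_tendsto (hlim.prodMk_nhds hg)
    (.of_forall fun n => linearCombination_mem_graph hSk _), hg, hF⟩

lemma IsGaussianPathMeasure.exists_isItoIntegral [SigmaFinite ν]
    (hP : IsGaussianPathMeasure ν K P)
    (hK : ∀ A B, K A B = inner ℝ (k A) (k B)) (hS : S.IsClosed) (hcore : S.HasCore (Dfin ν))
    (hSk : ∀ A, (chi ν A, k A) ∈ S.graph) {φ : X → ℝ} (hφ : MemLp φ 2 ν)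
    (hd : hφ.toLp φ ∈ S.domain) :
    ∃ F : PathSpace ν → ℝ, IsItoIntegral ν P φ F ∧ MemLp F 2 P := by
  obtain ⟨𝒜, α, hu, hv⟩ := exists_partition_tendsto hS hcore hSk (S.mem_graph ⟨_, hd⟩)
  obtain ⟨G, hG⟩ := cauchySeq_tendsto_of_complete (hP.cauchySeq_integralLp hK hv.cauchySeq)
  exact ⟨G, (hP.isItoIntegral_iff hφ).2 ⟨𝒜, α, hu, tendstoInMeasure_of_tendsto_Lp hG⟩,
    Lp.memLp G⟩

/-- The Itô isometry. -/
lemma IsGaussianPathMeasure.inner_isItoIntegral (hP : IsGaussianPathMeasure ν K P)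
    (hK : ∀ A B, K A B = inner ℝ (k A) (k B)) (hS : S.IsClosed)
    (hSk : ∀ A, (chi ν A, k A) ∈ S.graph) {φ ψ : X → ℝ} (hφ : MemLp φ 2 ν) (hψ : MemLp ψ 2 ν)
    (hdφ : hφ.toLp φ ∈ S.domain) (hdψ : hψ.toLp ψ ∈ S.domain) {F G : PathSpace ν → ℝ}
    (hF : IsItoIntegral ν P φ F) (hG : IsItoIntegral ν P ψ G) :
    Integrable (fun ω => F ω * G ω) P ∧
      ∫ ω, F ω * G ω ∂P = inner ℝ (S ⟨hφ.toLp φ, hdφ⟩) (S ⟨hψ.toLp ψ, hdψ⟩) := by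
  obtain ⟨u, hF2, c, hu, hcu, hcF⟩ := hP.exists_tendsto_of_isItoIntegral hK hS hSk hφ hF
  obtain ⟨v, hG2, d, hv, hdv, hdG⟩ := hP.exists_tendsto_of_isItoIntegral hK hS hSk hψ hG
  have h := hcF.inner (𝕜 := ℝ) hdG
  simp only [hP.inner_integralLp hK] at h
  have hinner := tendsto_nhds_unique h (hcu.inner (𝕜 := ℝ) hdv)
  -- Single-valuedness of the graph makes the limits `u` and `v` independent of the approximating
  -- sequences and of the versions.
  rw [S.mem_graph_snd_inj hu (S.mem_graph ⟨_, hdφ⟩) rfl,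
    S.mem_graph_snd_inj hv (S.mem_graph ⟨_, hdψ⟩) rfl] at hinner
  refine ⟨hF2.integrable_mul hG2, ?_⟩
  rw [← hinner, L2.inner_def]
  refine integral_congr_ae ?_
  filter_upwards [hF2.coeFn_toLp, hG2.coeFn_toLp] with ω h₁ h₂
  rw [h₁, h₂]
  simp [mul_comm]

end KernelField

theorem theorem5p1 {X : Type*} [MeasurableSpace X] (ν : Measure X) [SigmaFinite ν]
    (K : KernelField.Bfin ν → KernelField.Bfin ν → ℝ)
    (k : KernelField.Bfin ν → Lp ℝ 2 ν)
    (hK : ∀ A B, K A B = inner ℝ (k A) (k B))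
    (S : Lp ℝ 2 ν →ₗ.[ℝ] Lp ℝ 2 ν)
    (hS : S.IsClosed) (hcore : S.HasCore (KernelField.Dfin ν))
    (hSk : ∀ A, (KernelField.chi ν A, k A) ∈ S.graph)
    (P : Measure (KernelField.PathSpace ν))
    (hP : KernelField.IsGaussianPathMeasure ν K P) :
    (∀ φ : X → ℝ, AEMeasurable φ ν →
      ((∃ F : KernelField.PathSpace ν → ℝ,
          KernelField.IsItoIntegral ν P φ F ∧ MemLp F 2 P) ↔
        ∃ h : MemLp φ 2 ν, h.toLp φ ∈ S.domain)) ∧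
    (∀ (φ : X → ℝ) (h : MemLp φ 2 ν) (hd : h.toLp φ ∈ S.domain)
        (F : KernelField.PathSpace ν → ℝ), KernelField.IsItoIntegral ν P φ F →
      MemLp F 2 P ∧ ∫ ω, |F ω| ^ 2 ∂P = ‖S ⟨h.toLp φ, hd⟩‖ ^ 2) ∧
    (∀ (φ ψ : X → ℝ) (hφ : MemLp φ 2 ν) (hψ : MemLp ψ 2 ν)
        (hdφ : hφ.toLp φ ∈ S.domain) (hdψ : hψ.toLp ψ ∈ S.domain)
        (F G : KernelField.PathSpace ν → ℝ),
        KernelField.IsItoIntegral ν P φ F → KernelField.IsItoIntegral ν P ψ G →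
      Integrable (fun ω => F ω * G ω) P ∧
      ∫ ω, F ω * G ω ∂P = inner ℝ (S ⟨hφ.toLp φ, hdφ⟩) (S ⟨hψ.toLp ψ, hdψ⟩)) := by
  refine ⟨fun φ hφ => ⟨?_, ?_⟩, ?_, ?_⟩
  · rintro ⟨F, hF, -⟩
    have h := hF.memLp hφ
    obtain ⟨g, -, -, hg, -⟩ := hP.exists_tendsto_of_isItoIntegral hK hS hSk h hF
    exact ⟨h, LinearPMap.mem_domain_of_mem_graph hg⟩
  · rintro ⟨h, hd⟩
    exact hP.exists_isItoIntegral hK hS hcore hSk h hd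
  · intro φ h hd F hF
    obtain ⟨-, hF2, -⟩ := hP.exists_tendsto_of_isItoIntegral hK hS hSk h hF
    refine ⟨hF2, ?_⟩
    rw [← real_inner_self_eq_norm_sq,
      ← (hP.inner_isItoIntegral hK hS hSk h h hd hd hF hF).2]
    simp only [sq, abs_mul_abs_self]
  · intro φ ψ hφ hψ hdφ hdψ F G hF hG
    exact hP.inner_isItoIntegral hK hS hSk hφ hψ hdφ hdψ hF hG
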